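/- Rings are associative with unit, and homomorphisms preserve the unit. Let $f\colon A\to B$ be a ring epimorphism (an epimorphism in the category of rings) that is 1-finite, i.e. via $f$ the ring $B$ is a finitely presented left $A$-module of projective dimension at most one. For a set $\Sigma$ of maps between finitely generated projective left $A$-modules, $f$ is called the universal localisation of $A$ at $\Sigma$ if $B\otimes_A\sigma$ is an isomorphism for every $\sigma\in\Sigma$ and every ring homomorphism $g\colon A\to C$ such that $C\otimes_A\sigma$ is an isomorphism for all $\sigma\in\Sigma$ factors as $g=hf$ for a unique ring homomorphism $h\colon B\to C$; in other words, $B\cong A_\Sigma$ compatibly with the maps from $A$. Let $K_f$ be the complex of left $A$-modules $A\xrightarrow{f}B$ with $A$ in degree $-1$ and $B$ in degree $0$. Say that a map $g\colon P\to Q$ between finitely generated projective left $A$-modules resolves $K_f$ if there is a quasi-isomorphism to $K_f$ from the complex $P\xrightarrow{g}Q$ (with $P$ in degree $-1$ and $Q$ in degree $0$). Then: 1. $f$ is homological, i.e. $\operatorname{Tor}_i^A(B,B)=0$ for all $i>0$, if and only if $f$ is a universal localisation of $A$ at some set $\Sigma$ of maps between finitely generated projective left $A$-modules. 2. There exists a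 map $g$ between finitely generated projective left $A$-modules that resolves $K_f$. 3. If $f$ is homological, then for every map $g$ between finitely generated projective left $A$-modules that resolves $K_f$, $f$ is the universal localisation of $A$ at $\{g\}$; that is, $B\cong A_{\{g\}}$ compatibly with the maps from $A$. -/

import Mathlib

universe u

namespace RingEpi

open CategoryTheory CategoryTheory.Limits TensorProduct

noncomputable section

/-! ### Tensor product over a (noncommutative) ring, and Tor -/

section Tensor

variable {A : Type u} [Ring A]

/-- The subgroup of `X ⊗_ℤ M` generated by the elements `x a ⊗ m - x ⊗ a m`.
Right `A`-modules are modules over `Aᵐᵒᵖ`. -/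
def balancedRelations (X : ModuleCat.{u} Aᵐᵒᵖ) (M : ModuleCat.{u} A) :
    Submodule ℤ (X ⊗[ℤ] M) :=
  Submodule.span ℤ {t | ∃ (x : X) (a : A) (m : M),
    t = (MulOpposite.op a • x) ⊗ₜ[ℤ] m - x ⊗ₜ[ℤ] (a • m)}

/-- The abelian group `X ⊗_A M`, for a right `A`-module `X` and a left `A`-module `M`. -/
abbrev TensorOver (X : ModuleCat.{u} Aᵐᵒᵖ) (M : ModuleCat.{u} A) : Type u :=
  (X ⊗[ℤ] M) ⧸ balancedRelations X M

theorem balancedRelations_le_comap (X : ModuleCat.{u} Aᵐᵒᵖ) {M N : ModuleCat.{u} A}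
    (φ : M ⟶ N) :
    balancedRelations X M ≤ (balancedRelations X N).comap
      (TensorProduct.map (LinearMap.id : X →ₗ[ℤ] X) (φ.hom.toAddMonoidHom.toIntLinearMap)) := by
  refine Submodule.span_le.2 ?_
  rintro _ ⟨x, a, m, rfl⟩
  exact Submodule.subset_span ⟨x, a, φ.hom m, by simp⟩

/-- The homomorphism `X ⊗_A φ : X ⊗_A M → X ⊗_A N`, `x ⊗ m ↦ x ⊗ φ m`. -/
def TensorOver.map (X : ModuleCat.{u} Aᵐᵒᵖ) {M N : ModuleCat.{u} A} (φ : M ⟶ N) :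
    TensorOver X M →ₗ[ℤ] TensorOver X N :=
  Submodule.mapQ _ _
    (TensorProduct.map (LinearMap.id : X →ₗ[ℤ] X) (φ.hom.toAddMonoidHom.toIntLinearMap))
    (balancedRelations_le_comap X φ)

theorem TensorOver.map_id (X : ModuleCat.{u} Aᵐᵒᵖ) (M : ModuleCat.{u} A) :
    TensorOver.map X (𝟙 M) = LinearMap.id :=
  Submodule.linearMap_qext _ (TensorProduct.ext' fun _ _ => rfl)

theorem TensorOver.map_comp (X : ModuleCat.{u} Aᵐᵒᵖ) {M N L : ModuleCat.{u} A}
    (φ : M ⟶ N) (ψ : N ⟶ L) :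
    TensorOver.map X (φ ≫ ψ) = (TensorOver.map X ψ).comp (TensorOver.map X φ) :=
  Submodule.linearMap_qext _ (TensorProduct.ext' fun _ _ => rfl)

theorem TensorOver.map_add (X : ModuleCat.{u} Aᵐᵒᵖ) {M N : ModuleCat.{u} A} (φ ψ : M ⟶ N) :
    TensorOver.map X (φ + ψ) = TensorOver.map X φ + TensorOver.map X ψ :=
  Submodule.linearMap_qext _ (TensorProduct.ext' fun x m =>
    congrArg (Submodule.Quotient.mk (p := balancedRelations X N))
      (TensorProduct.tmul_add x (φ.hom m) (ψ.hom m)))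

/-- The functor `X ⊗_A -` from left `A`-modules to abelian groups. -/
def tensorFunctor (X : ModuleCat.{u} Aᵐᵒᵖ) : ModuleCat.{u} A ⥤ ModuleCat.{u} ℤ where
  obj M := ModuleCat.of ℤ (TensorOver X M)
  map φ := ModuleCat.ofHom (TensorOver.map X φ)
  map_id M := by rw [TensorOver.map_id]; rfl
  map_comp φ ψ := by rw [TensorOver.map_comp]; rfl

instance tensorFunctor_additive (X : ModuleCat.{u} Aᵐᵒᵖ) : (tensorFunctor X).Additive where
  map_add {_ _ φ ψ} := congrArg ModuleCat.ofHom (TensorOver.map_add X φ ψ)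

/-- `Tor_n^A(X, M)`: the value at `M` of the `n`-th left derived functor of `X ⊗_A -`. -/
def torGroup (n : ℕ) (X : ModuleCat.{u} Aᵐᵒᵖ) (M : ModuleCat.{u} A) : ModuleCat.{u} ℤ :=
  ((tensorFunctor X).leftDerived n).obj M

end Tensor

/-! ### Ring homomorphisms -/

section RingHoms

variable {A B : Type u} [Ring A] [Ring B]

/-- `B` as a left `A`-module via `f`, i.e. `a • b = f a * b`. -/
abbrev leftMod (f : A →+* B) : ModuleCat.{u} A :=
  (ModuleCat.restrictScalars f).obj (ModuleCat.of B B)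

/-- `B` as a right `A`-module via `f`, i.e. `b • a = b * f a`. -/
abbrev rightMod (f : A →+* B) : ModuleCat.{u} Aᵐᵒᵖ :=
  (ModuleCat.restrictScalars f.op).obj (ModuleCat.of Bᵐᵒᵖ B)

/-- `f` as a homomorphism of left `A`-modules `A → B`. -/
def asModuleHom (f : A →+* B) : ModuleCat.of A A ⟶ leftMod f :=
  ModuleCat.ofHom (Y := leftMod f)
    { toFun := fun a => f a
      map_add' := fun a b => map_add f a b
      map_smul' := fun a b => map_mul f a b }

/-- A ring epimorphism: an epimorphism in the category of unital rings. -/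
def IsRingEpi (f : A →+* B) : Prop := Epi (RingCat.ofHom f)

/-- A `1`-finite ring epimorphism. -/
structure IsOneFinite (f : A →+* B) : Prop where
  epi : IsRingEpi f
  finitePresentation : Module.FinitePresentation A (leftMod f)
  projectiveDimension_le_one : HasProjectiveDimensionLE (leftMod f) 1

/-- A homological ring epimorphism. -/
structure IsHomological (f : A →+* B) : Prop where
  epi : IsRingEpi f
  tor_eq_zero : ∀ i : ℕ, 0 < i → IsZero (torGroup i (rightMod f) (leftMod f))

/-- A map between finitely generated projective left `A`-modules. -/
def IsFGProjMap {P Q : ModuleCat.{u} A} (_ : P ⟶ Q) : Prop :=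
  (Module.Finite A P ∧ Module.Projective A P) ∧ (Module.Finite A Q ∧ Module.Projective A Q)

/-- `B ⊗_A σ` is an isomorphism. (It is a map of left `B`-modules, so it is invertible as such
exactly when it is invertible as a map of abelian groups.) -/
def Inverts (f : A →+* B) {P Q : ModuleCat.{u} A} (σ : P ⟶ Q) : Prop :=
  IsIso ((tensorFunctor (rightMod f)).map σ)

/-- `f : A → B` is the universal localisation `A → A_S` of `A` at the set `S` of maps between
finitely generated projective left `A`-modules. -/
structure IsUniversalLocalisationAt (f : A →+* B) (S : Set (Arrow (ModuleCat.{u} A))) :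
    Prop where
  fgProj : ∀ σ ∈ S, IsFGProjMap σ.hom
  inverts : ∀ σ ∈ S, Inverts f σ.hom
  existsUnique_lift : ∀ (C : Type u) [Ring C] (g : A →+* C),
    (∀ σ ∈ S, Inverts g σ.hom) → ∃! h : B →+* C, h.comp f = g

/-- `f` is a universal localisation (at some set of maps). -/
def IsUniversalLocalisation (f : A →+* B) : Prop :=
  ∃ S : Set (Arrow (ModuleCat.{u} A)), IsUniversalLocalisationAt f S

/-- The complex `P → Q` of left `A`-modules, with `P` in degree `-1` and `Q` in degree `0`. -/
def twoTerm {P Q : ModuleCat.{u} A} (g : P ⟶ Q) : CochainComplex (ModuleCat.{u} A) ℤ :=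
  HomologicalComplex.double g (c := ComplexShape.up ℤ) (i₀ := -1) (i₁ := 0) (by simp)

/-- The complex `K_f`, namely `f : A → B` with `A` in degree `-1`. -/
def coneComplex (f : A →+* B) : CochainComplex (ModuleCat.{u} A) ℤ :=
  twoTerm (asModuleHom f)

/-- `g` is a map between finitely generated projective left `A`-modules such that the complex
`g : P → Q` admits a quasi-isomorphism to `K_f`. -/
def ResolvesCone (f : A →+* B) {P Q : ModuleCat.{u} A} (g : P ⟶ Q) : Prop :=
  IsFGProjMap g ∧ ∃ φ : twoTerm g ⟶ coneComplex f, QuasiIso φ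

end RingHoms

end

end RingEpi

/-!
Call a module `N` local for a map `σ` if every map from the source of `σ` to `N` extends uniquely
along `σ`. A ring homomorphism `h : A → C` inverts `σ` if and only if all `C`-modules are local for
`σ`, and when `σ` is a map between finitely generated projectives it suffices that `C` itself is. On
the other hand, `h` factors uniquely through `f` as soon as `C` is local for `f`, and if `f` is an
epimorphism all `B`-modules are local for `f`.

A two-term complex `g : P → Q` resolves `K_f` exactly when it is part of a square from `g` to `f`
whose total complex `0 → P → Q ⊕ A → B → 0` is exact. The square is then a pushout, so modules that
are local for `g` are local for `f`. Conversely `B` is local for `g`, hence `g` is inverted by `f`,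
provided that every map from `P` to a `B`-module extends to `Q ⊕ A`. Computing `Tor^A(B, B)` from
this resolution of `B` shows that the extension property is equivalent to `f` being homological.

If `f` is the universal localisation at `S` and a module `E` is local for all maps in `S`, then so
is the endomorphism ring of the abelian group `E`, whence `E` is a `B`-module. In particular an
extension of `B` by a `B`-module is a `B`-module, so it splits, and the extension property follows.
-/

namespace RingEpi

open CategoryTheory CategoryTheory.Limits TensorProduct

noncomputable section

section Local
variable {C D : Type*} [Category* C] [Category* D] {P Q : C}

/-- `N` is `σ`-local: every map from the source of `σ` to `N` extends uniquely along `σ`. -/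
def IsLocalFor (σ : P ⟶ Q) (N : C) : Prop :=
  Function.Bijective fun β : Q ⟶ N => σ ≫ β

theorem isIso_iff_forall_isLocalFor {σ : P ⟶ Q} : IsIso σ ↔ ∀ N, IsLocalFor σ N :=
  isIso_iff_coyoneda_map_bijective σ

theorem isIso_of_isLocalFor {σ : P ⟶ Q} (hP : IsLocalFor σ P) (hQ : IsLocalFor σ Q) : IsIso σ := by
  obtain ⟨τ, hτ : σ ≫ τ = 𝟙 P⟩ := hP.2 (𝟙 P)
  exact ⟨τ, hτ, hQ.1 (by simp [reassoc_of% hτ])⟩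

theorem IsLocalFor.of_isLimit {σ : P ⟶ Q} {ι : Type*} {X : ι → C} {c : Fan X} (hc : IsLimit c)
    (hX : ∀ i, IsLocalFor σ (X i)) : IsLocalFor σ c.pt := by
  refine ⟨fun β γ hβγ => Fan.IsLimit.hom_ext hc _ _ fun i => (hX i).1 ?_, fun α => ?_⟩
  · simpa using congr($hβγ ≫ c.proj i)
  · choose β hβ using fun i => (hX i).2 (α ≫ c.proj i)
    exact ⟨Fan.IsLimit.lift hc β, Fan.IsLimit.hom_ext hc _ _ fun i => by simpa using hβ i⟩

theorem IsLocalFor.of_retract {σ : P ⟶ Q} {M N : C} (hN : IsLocalFor σ N) (r : Retract M N) :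
    IsLocalFor σ M := by
  constructor
  · intro β γ hβγ
    rw [← cancel_mono r.i]
    exact hN.1 (by simpa using congr($hβγ ≫ r.i))
  · intro α
    obtain ⟨β, hβ : σ ≫ β = α ≫ r.i⟩ := hN.2 (α ≫ r.i)
    exact ⟨β ≫ r.r, by simp [reassoc_of% hβ]⟩

theorem isLocalFor_map_iff {F : C ⥤ D} {G : D ⥤ C} (adj : F ⊣ G) {σ : P ⟶ Q} {N : D} :
    IsLocalFor (F.map σ) N ↔ IsLocalFor σ (G.obj N) := by
  have : (adj.homEquiv P N) ∘ (fun β => F.map σ ≫ β) = (fun β => σ ≫ β) ∘ (adj.homEquiv Q N) := by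
    ext β
    simp [adj.homEquiv_naturality_left]
  rw [IsLocalFor, ← (adj.homEquiv P N).comp_bijective, this, Equiv.bijective_comp, IsLocalFor]

end Local

section BaseChange

variable {A C : Type u} [Ring A] [Ring C] (h : A →+* C)

theorem balancedRelations_le_comap_rTensor_mulLeft (M : ModuleCat.{u} A) (c : C) :
    balancedRelations (rightMod h) M ≤ (balancedRelations (rightMod h) M).comap
      (LinearMap.rTensor (R := ℤ) (N := C) (P := C) M (AddMonoidHom.mulLeft c).toIntLinearMap) := by
  refine Submodule.span_le.2 ?_
  rintro _ ⟨(x : C), a, m, rfl⟩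
  refine Submodule.subset_span ⟨(c * x : C), a, m, (map_sub (LinearMap.rTensor ..) _ _).trans ?_⟩
  exact congrArg (fun y : C => y ⊗ₜ[ℤ] m - (c * x : C) ⊗ₜ[ℤ] (a • m)) (mul_assoc c x (h a)).symm

/-- The relations defining `C ⊗_A M`, as a left `C`-submodule of `C ⊗_ℤ M`. -/
def scalarRelations (M : ModuleCat.{u} A) : Submodule C (C ⊗[ℤ] M) where
  __ := balancedRelations (rightMod h) M
  smul_mem' c _ ht := balancedRelations_le_comap_rTensor_mulLeft h M c ht

variable {h} in
theorem scalarRelations_mkQ_tmul_smul {M : ModuleCat.{u} A} (c : C) (a : A) (m : M) :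
    (scalarRelations h M).mkQ (c ⊗ₜ (a • m)) = (scalarRelations h M).mkQ ((c * h a) ⊗ₜ m) :=
  have hmem : _ ∈ balancedRelations (rightMod h) M := Submodule.subset_span ⟨c, a, m, rfl⟩
  ((Submodule.Quotient.eq (scalarRelations h M)).2 hmem).symm

/-- The functor `C ⊗_A -` from left `A`-modules to left `C`-modules. Its composite with the
forgetful functor to abelian groups is `tensorFunctor (rightMod h)`. -/
def extendScalars : ModuleCat.{u} A ⥤ ModuleCat.{u} C where
  obj M := ModuleCat.of C ((C ⊗[ℤ] M) ⧸ scalarRelations h M)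
  map {M N} φ := ModuleCat.ofHom
    { TensorOver.map (rightMod h) φ with
      map_smul' := by
        intro c t
        obtain ⟨t, rfl⟩ := Submodule.Quotient.mk_surjective _ t
        exact congrArg (scalarRelations h N).mkQ
          ((AlgebraTensorModule.lTensor C C φ.hom.toAddMonoidHom.toIntLinearMap).map_smul c t) }
  map_id M := by
    ext
    rfl
  map_comp φ ψ := by
    ext
    rfl

theorem inverts_iff_isIso_extendScalars_map {P Q : ModuleCat.{u} A} (σ : P ⟶ Q) :
    Inverts h σ ↔ IsIso ((extendScalars h).map σ) :=
  (ConcreteCategory.isIso_iff_bijective _).trans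
    (ConcreteCategory.isIso_iff_bijective ((extendScalars h).map σ)).symm

theorem mono_tensorFunctor_map_iff {P Q : ModuleCat.{u} A} (σ : P ⟶ Q) :
    Mono ((tensorFunctor (rightMod h)).map σ) ↔ Mono ((extendScalars h).map σ) :=
  (ModuleCat.mono_iff_injective _).trans
    (ModuleCat.mono_iff_injective ((extendScalars h).map σ)).symm

/-- The map `m ↦ 1 ⊗ m`. -/
def extendScalarsUnit (M : ModuleCat.{u} A) :
    M ⟶ (ModuleCat.restrictScalars h).obj ((extendScalars h).obj M) :=
  ModuleCat.ofHom (Y := (ModuleCat.restrictScalars h).obj ((extendScalars h).obj M))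
    { toFun := fun m => (scalarRelations h M).mkQ (1 ⊗ₜ m)
      map_add' := fun m m' => by rw [tmul_add]; exact map_add _ _ _
      map_smul' := fun a m => by
        rw [scalarRelations_mkQ_tmul_smul, one_mul, ← mul_one (h a)]
        rfl }

variable {h} in
/-- The `C`-linear map `c ⊗ m ↦ c • α m`. -/
def extendScalarsDesc {M : ModuleCat.{u} A} {N : ModuleCat.{u} C}
    (α : M ⟶ (ModuleCat.restrictScalars h).obj N) : (extendScalars h).obj M ⟶ N :=
  let l : C ⊗[ℤ] M →ₗ[C] N := AlgebraTensorModule.lift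
    (LinearMap.toSpanSingleton C (M →ₗ[ℤ] N) (α.hom.toAddMonoidHom.toIntLinearMap (M := M)))
  have hl : balancedRelations (rightMod h) M ≤ LinearMap.ker (l.restrictScalars ℤ) :=
    Submodule.span_le.2 <| by
      rintro _ ⟨(c : C), a, m, rfl⟩
      refine (map_sub l ((c * h a) ⊗ₜ m) (c ⊗ₜ (a • m))).trans (sub_eq_zero.2 ?_)
      exact (mul_smul c (h a) (α.hom m : N)).trans
        (congrArg (c • · : N → N) (map_smul α.hom a m).symm)
  ModuleCat.ofHom ((scalarRelations h M).liftQ l fun _ ht => hl ht)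

/-- `C ⊗_A -` is left adjoint to restriction of scalars. -/
def extendRestrictScalarsAdj : extendScalars h ⊣ ModuleCat.restrictScalars h :=
  Adjunction.mkOfHomEquiv
    { homEquiv M N :=
        { toFun φ := extendScalarsUnit h M ≫ (ModuleCat.restrictScalars h).map φ
          invFun := extendScalarsDesc
          left_inv φ := by
            refine ModuleCat.hom_ext (Submodule.linearMap_qext _ ?_)
            ext m
            exact one_smul C (φ.hom ((scalarRelations h M).mkQ (1 ⊗ₜ m)))
          right_inv α := by
            ext m
            exact one_smul C (α.hom m : N) }
      homEquiv_naturality_left_symm f g :=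
        ModuleCat.hom_ext (Submodule.linearMap_qext _ (by ext; rfl)) }

variable {h}

theorem inverts_iff_forall_isLocalFor {P Q : ModuleCat.{u} A} {σ : P ⟶ Q} :
    Inverts h σ ↔ ∀ N, IsLocalFor σ ((ModuleCat.restrictScalars h).obj N) := by
  simp only [inverts_iff_isIso_extendScalars_map, isIso_iff_forall_isLocalFor,
    isLocalFor_map_iff (extendRestrictScalarsAdj h)]

instance finite_extendScalars (M : ModuleCat.{u} A) [Module.Finite A M] :
    Module.Finite C ((extendScalars h).obj M) := by
  obtain ⟨s, hs⟩ := Module.Finite.fg_top (R := A) (M := M)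
  set N := Submodule.span C ((extendScalarsUnit h M).hom '' s)
  have hN : ModuleCat.ofHom N.mkQ = 0 := by
    refine ((extendRestrictScalarsAdj h).homEquiv _ _).injective (ModuleCat.hom_ext ?_)
    refine LinearMap.ext_on hs fun m hm => ?_
    exact (Submodule.Quotient.mk_eq_zero N).2 (Submodule.subset_span ⟨m, hm, rfl⟩)
  have hN' : N = ⊤ := by rw [← N.ker_mkQ, ← ModuleCat.hom_ofHom N.mkQ, hN]; exact LinearMap.ker_zero
  exact ⟨hN' ▸ Submodule.fg_span (s.finite_toSet.image _)⟩

instance projective_extendScalars (M : ModuleCat.{u} A) [Projective M] :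
    Projective ((extendScalars h).obj M) :=
  (extendRestrictScalarsAdj h).map_projective M inferInstance

theorem IsLocalFor.of_finite_of_projective {P Q : ModuleCat.{u} C} {σ : P ⟶ Q}
    (hσ : IsLocalFor σ (ModuleCat.of C C)) (N : ModuleCat.{u} C) [Module.Finite C N]
    [Projective N] : IsLocalFor σ N := by
  have : Module.Projective C N := (IsProjective.iff_projective N).2 ‹_›
  obtain ⟨n, p, i, -, -, hpi⟩ := Module.Finite.exists_comp_eq_id_of_projective C N
  have hn : IsLocalFor σ (ModuleCat.of C (Fin n → C)) :=
     .of_isLimit (ModuleCat.productConeIsLimit fun _ : Fin n => ModuleCat.of C C) fun _ => hσ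
  exact hn.of_retract ⟨ModuleCat.ofHom i, ModuleCat.ofHom p, ModuleCat.hom_ext hpi⟩

theorem IsLocalFor.inverts {P Q : ModuleCat.{u} A} {σ : P ⟶ Q} (hσ : IsFGProjMap σ)
    (hC : IsLocalFor σ (leftMod h)) : Inverts h σ := by
  obtain ⟨⟨_, _⟩, _, _⟩ := hσ
  have := P.projective_of_module_projective
  have := Q.projective_of_module_projective
  rw [← isLocalFor_map_iff (extendRestrictScalarsAdj h)] at hC
  exact (inverts_iff_isIso_extendScalars_map h σ).2
    (isIso_of_isLocalFor (hC.of_finite_of_projective _) (hC.of_finite_of_projective _))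

end BaseChange

section Epi

variable {A B : Type u} [Ring A] [Ring B] {f : A →+* B}

theorem IsRingEpi.hom_ext (hf : IsRingEpi f) {R : Type u} [Ring R] {k k' : B →+* R}
    (hk : k.comp f = k'.comp f) : k = k' :=
  have : Epi (RingCat.ofHom f) := hf
  congrArg RingCat.Hom.hom ((cancel_epi (RingCat.ofHom f) (g := RingCat.ofHom k)
    (h := RingCat.ofHom k')).1 (congrArg RingCat.ofHom hk))

theorem IsRingEpi.commute (hf : IsRingEpi f) {R : Type u} [Ring R] (ρ : B →+* R) {r : R}
    (hr : ∀ a, Commute r (ρ (f a))) (b : B) : Commute r (ρ b) := by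
  -- `ρ` and its deformation by the inner derivation `[r, ·]` agree on `A` over the dual numbers
  let ρ' : B →+* TrivSqZeroExt R R :=
    { toFun b := .inl (ρ b) + .inr (r * ρ b - ρ b * r)
      map_one' := by simp
      map_mul' b b' := by
        ext
        · simp
        · simp only [map_mul, TrivSqZeroExt.snd_add, TrivSqZeroExt.snd_mul, TrivSqZeroExt.snd_inl,
            TrivSqZeroExt.snd_inr, TrivSqZeroExt.fst_add, TrivSqZeroExt.fst_inl,
            TrivSqZeroExt.fst_inr, smul_eq_mul, MulOpposite.smul_eq_mul_unop, MulOpposite.unop_op]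
          noncomm_ring
      map_zero' := by simp
      map_add' b b' := by
        ext
        · simp
        · simp only [map_add, TrivSqZeroExt.snd_add, TrivSqZeroExt.snd_inl, TrivSqZeroExt.snd_inr]
          noncomm_ring }
  have hρ : (TrivSqZeroExt.inlHom R R).comp ρ = ρ' := hf.hom_ext (by
    ext a
    · simp [ρ']
    · simp [ρ', (hr a).eq])
  have hb : (0 : R) = r * ρ b - ρ b * r := by
    simpa [ρ'] using congrArg TrivSqZeroExt.snd (DFunLike.congr_fun hρ b)
  exact sub_eq_zero.1 hb.symm

theorem IsRingEpi.full_restrictScalars (hf : IsRingEpi f) :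
    (ModuleCat.restrictScalars.{u} f).Full where
  map_surjective {M N} φ := by
    let r : AddMonoid.End (M × N) :=
      (AddMonoidHom.inr M N).comp ((φ.hom.toAddMonoidHom : M →+ N).comp (AddMonoidHom.fst M N))
    have hr (b : B) : Commute r (Module.toAddMonoidEnd B (M × N) b) :=
      hf.commute (Module.toAddMonoidEnd B (M × N)) (r := r) (fun a => AddMonoidHom.ext fun x =>
        Prod.ext (smul_zero (f a)).symm (φ.hom.map_smul a x.1)) b
    exact ⟨ModuleCat.ofHom
      { φ.hom with
        map_smul' b m := congrArg Prod.snd (DFunLike.congr_fun (hr b) (m, 0)) }, rfl⟩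

theorem IsRingEpi.isLocalFor_asModuleHom (hf : IsRingEpi f) (N : ModuleCat.{u} B) :
    IsLocalFor (asModuleHom f) ((ModuleCat.restrictScalars f).obj N) := by
  have := hf.full_restrictScalars
  constructor
  · intro β γ hβγ
    obtain ⟨β, rfl⟩ := (ModuleCat.restrictScalars f).map_surjective β
    obtain ⟨γ, rfl⟩ := (ModuleCat.restrictScalars f).map_surjective γ
    have h1 : β.hom (f 1) = γ.hom (f 1) := congr($hβγ (1 : A))
    rw [map_one] at h1
    exact congrArg _ (ModuleCat.hom_ext (LinearMap.ext_ring h1))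
  · intro α
    refine ⟨(ModuleCat.restrictScalars f).map (ModuleCat.ofHom
      (LinearMap.toSpanSingleton B N (α.hom (1 : A) : N))), ?_⟩
    exact ModuleCat.hom_ext (LinearMap.ext_ring
      ((congrArg (· • (α.hom (1 : A) : N)) (map_one f)).trans (one_smul _ _)))

theorem existsUnique_comp_eq_of_isLocalFor {C : Type u} [Ring C] {h : A →+* C}
    (hC : IsLocalFor (asModuleHom f) (leftMod h)) : ∃! k : B →+* C, k.comp f = h := by
  obtain ⟨θ, hθ : asModuleHom f ≫ θ = asModuleHom h⟩ := hC.2 (asModuleHom h)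
  let t (b : B) : C := θ.hom (b : leftMod f)
  have ht (a : A) : t (f a) = h a := congr($hθ a)
  have hmul (b c : B) : t (b * c) = t b * t c := by
    let β := (ModuleCat.restrictScalars f).map
      (ModuleCat.ofHom (LinearMap.toSpanSingleton B B c)) ≫ θ
    let γ := θ ≫ (ModuleCat.restrictScalars h).map
      (ModuleCat.ofHom (LinearMap.toSpanSingleton C C (t c)))
    have hβγ : β = γ := hC.1 <| ModuleCat.hom_ext <| LinearMap.ext fun a =>
      (θ.hom.map_smul a c).trans (congrArg (· * t c) (ht a).symm)
    exact congr($hβγ b)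
  refine ⟨⟨⟨⟨t, ?_⟩, hmul⟩, map_zero θ.hom, map_add θ.hom⟩, RingHom.ext ht, ?_⟩
  · rw [← map_one f, ht, map_one]
  · rintro k rfl
    let κ : leftMod f ⟶ leftMod (k.comp f) :=
      ModuleCat.ofHom (X := leftMod f) (Y := leftMod (k.comp f))
        { k.toAddMonoidHom with map_smul' a b := map_mul k (f a) b }
    have hκ : κ = θ := hC.1 hθ.symm
    exact RingHom.ext fun b => congr($hκ b)

end Epi

section Pushout

variable {C : Type*} [Category* C] {P Q X Y N : C} {g : P ⟶ Q} {l : P ⟶ X} {r : Q ⟶ Y} {f : X ⟶ Y}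

theorem IsLocalFor.of_isPushout (hN : IsLocalFor g N) (sq : IsPushout g l r f) :
    IsLocalFor f N := by
  refine ⟨fun β γ (hβγ : f ≫ β = f ≫ γ) => sq.hom_ext (hN.1 ?_) hβγ, fun α => ?_⟩
  · simp [reassoc_of% sq.w, hβγ]
  · obtain ⟨β, hβ : g ≫ β = l ≫ α⟩ := hN.2 (l ≫ α)
    exact ⟨sq.desc β α hβ, sq.inr_desc β α hβ⟩

theorem IsLocalFor.of_isPushout_of_exists_extension [Preadditive C] [HasBinaryBiproduct Q X]
    (hN : IsLocalFor f N) (sq : IsPushout g l r f)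
    (hext : ∀ α : P ⟶ N, ∃ β, biprod.lift g (-l) ≫ β = α) : IsLocalFor g N := by
  constructor
  · intro β γ (hβγ : g ≫ β = g ≫ γ)
    have hw : g ≫ (β - γ) = l ≫ 0 := by simp [hβγ]
    have hδ : sq.desc (β - γ) 0 hw = 0 := hN.1 (by simp)
    rw [← sub_eq_zero, ← sq.inl_desc (β - γ) 0 hw, hδ, comp_zero]
  · intro α
    obtain ⟨β : Q ⊞ X ⟶ N, rfl⟩ := hext α
    obtain ⟨γ, hγ : f ≫ γ = biprod.inr ≫ β⟩ := hN.2 (biprod.inr ≫ β)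
    refine ⟨biprod.inl ≫ β - r ≫ γ, ?_⟩
    simp [biprod.lift_eq, reassoc_of% sq.w, hγ, sub_eq_add_neg]

theorem isPushout_of_shortExact [Preadditive C] [Balanced C] [HasBinaryBiproduct Q X]
    (sq : CommSq g l r f) (hS : sq.shortComplex.ShortExact) : IsPushout g l r f :=
  ⟨sq, ⟨sq.isColimitEquivIsColimitCokernelCofork.symm hS.gIsCokernel⟩⟩

end Pushout

section Extension

variable {C : Type*} [Category* C] [Abelian C] {S : ShortComplex C}

theorem IsLocalFor.of_shortExact (hS : S.ShortExact) {P Q : C} [Projective Q] {σ : P ⟶ Q}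
    (h₁ : IsLocalFor σ S.X₁) (h₃ : IsLocalFor σ S.X₃) : IsLocalFor σ S.X₂ := by
  have := hS.mono_f
  have := hS.epi_g
  constructor
  · intro β γ (hβγ : σ ≫ β = σ ≫ γ)
    have hg : (β - γ) ≫ S.g = 0 := h₃.1 (by simp [reassoc_of% hβγ])
    have hlift : hS.exact.lift (β - γ) hg = 0 := h₁.1 (by simp [← cancel_mono S.f, hβγ])
    rw [← sub_eq_zero, ← hS.exact.lift_f (β - γ) hg, hlift, zero_comp]
  · intro α
    obtain ⟨β, hβ : σ ≫ β = α ≫ S.g⟩ := h₃.2 (α ≫ S.g)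
    have hg : (α - σ ≫ Projective.factorThru β S.g) ≫ S.g = 0 := by simp [hβ]
    obtain ⟨γ, hγ : σ ≫ γ = hS.exact.lift _ hg⟩ := h₁.2 (hS.exact.lift _ hg)
    exact ⟨Projective.factorThru β S.g + γ ≫ S.f, by simp [reassoc_of% hγ]⟩

theorem exists_pushout_shortExact (hS : S.ShortExact) {N : C} (α : S.X₁ ⟶ N) :
    ∃ (E : C) (i : N ⟶ E) (π : E ⟶ S.X₃) (w : i ≫ π = 0) (j : S.X₂ ⟶ E),
      (ShortComplex.mk i π w).ShortExact ∧ S.f ≫ j = α ≫ i := by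
  have := hS.mono_f
  have := hS.epi_g
  let π : pushout S.f α ⟶ S.X₃ := pushout.desc S.g 0 (by simp)
  have hπ : pushout.inl S.f α ≫ π = S.g := pushout.inl_desc _ _ _
  have w : pushout.inr S.f α ≫ π = 0 := pushout.inr_desc _ _ _
  have : Epi π := epi_of_epi_fac hπ
  refine ⟨_, _, π, w, pushout.inl S.f α, ⟨ShortComplex.exact_of_g_is_cokernel _ ?_⟩,
    pushout.condition⟩
  refine CokernelCofork.IsColimit.ofπ' _ _ fun k hk => ?_
  have hk' : S.f ≫ pushout.inl S.f α ≫ k = 0 := by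
    rw [pushout.condition_assoc, hk, comp_zero]
  refine ⟨hS.exact.desc _ hk', pushout.hom_ext ?_ ?_⟩
  · rw [reassoc_of% hπ, hS.exact.g_desc]
  · rw [reassoc_of% w, zero_comp, hk]

end Extension

section DerivedFunctors

variable {C D : Type*} [Category* C] [Category* D] [Abelian C] [Abelian D]

/-- The chain complex `P ⟶ Q`, with `Q` in degree `0`. -/
abbrev twoTermChain {P Q : C} (d : P ⟶ Q) : ChainComplex C ℕ :=
  HomologicalComplex.double d (c := ComplexShape.down ℕ) (i₀ := 1) (i₁ := 0) (by simp)

section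
variable {P Q : C} (d : P ⟶ Q)

/-- The degree one term of `twoTermChain d`. -/
def twoTermChainXOneIso : (twoTermChain d).X 1 ≅ P := HomologicalComplex.doubleXIso₀ d _

/-- The degree zero term of `twoTermChain d`. -/
def twoTermChainXZeroIso : (twoTermChain d).X 0 ≅ Q :=
  HomologicalComplex.doubleXIso₁ d _ (by simp)

theorem twoTermChain_d :
    (twoTermChain d).d 1 0 = (twoTermChainXOneIso d).hom ≫ d ≫ (twoTermChainXZeroIso d).inv :=
  HomologicalComplex.double_d d _ (by simp)

theorem isZero_twoTermChain_X_add_two (n : ℕ) : IsZero ((twoTermChain d).X (n + 2)) :=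
  HomologicalComplex.isZero_double_X d _ (n + 2) (by simp) (by simp)

theorem exactAt_one_map_twoTermChain_iff (F : C ⥤ D) [F.Additive] :
    ((F.mapHomologicalComplex _).obj (twoTermChain d)).ExactAt 1 ↔ Mono (F.map d) := by
  rw [HomologicalComplex.exactAt_iff' _ 2 1 0 (by simp) (by simp), ShortComplex.exact_iff_mono _
    ((F.map_isZero (isZero_twoTermChain_X_add_two d 0)).eq_of_src _ _)]
  change Mono (F.map ((twoTermChain d).d 1 0)) ↔ _
  rw [twoTermChain_d, F.map_comp, F.map_comp]
  exact ((MorphismProperty.monomorphisms D).cancel_left_of_respectsIso _ _).trans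
    ((MorphismProperty.monomorphisms D).cancel_right_of_respectsIso _ _)

theorem exactAt_add_two_map_twoTermChain (F : C ⥤ D) [F.Additive] (n : ℕ) :
    ((F.mapHomologicalComplex _).obj (twoTermChain d)).ExactAt (n + 2) :=
  ShortComplex.exact_of_isZero_X₂ _ (F.map_isZero (isZero_twoTermChain_X_add_two d n))

end

variable {S : ShortComplex C}

/-- The augmentation of `twoTermChain S.f` given by `S.g`. -/
def twoTermChainπ (S : ShortComplex C) :
    twoTermChain S.f ⟶ (ChainComplex.single₀ C).obj S.X₃ :=
  (ChainComplex.toSingle₀Equiv _ _).symm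
    ⟨(twoTermChainXZeroIso S.f).hom ≫ S.g, by simp [twoTermChain_d]⟩

theorem quasiIso_twoTermChainπ (hS : S.ShortExact) : QuasiIso (twoTermChainπ S) where
  quasiIsoAt := by
    have := hS.mono_f
    have hd : (twoTermChainXOneIso S.f).hom ≫ S.f =
        (twoTermChain S.f).d 1 0 ≫ (twoTermChainXZeroIso S.f).hom := by
      simp [twoTermChain_d]
    have hg : (twoTermChainXZeroIso S.f).hom ≫ S.g = (twoTermChainπ S).f 0 :=
      (ChainComplex.toSingle₀Equiv_symm_apply_f_zero _ _).symm
    rintro (_ | n)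
    · rw [ChainComplex.quasiIsoAt₀_iff, ShortComplex.quasiIso_iff_of_zeros' _
        ((twoTermChain S.f).shape 0 0 (by simp)) rfl rfl]
      refine (ShortComplex.exact_and_epi_g_iff_of_iso (S₂ := S) ?_).2 ⟨hS.exact, hS.epi_g⟩
      exact ShortComplex.isoMk (twoTermChainXOneIso S.f) (twoTermChainXZeroIso S.f) (Iso.refl _) hd
        (hg.trans (Category.comp_id _).symm)
    · rw [quasiIsoAt_iff_exactAt' _ _ (ChainComplex.exactAt_succ_single_obj _ _)]
      obtain _ | n := n
      · exact (exactAt_one_map_twoTermChain_iff S.f (𝟭 C)).2 this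
      · exact exactAt_add_two_map_twoTermChain S.f (𝟭 C) n

/-- The projective resolution of `S.X₃` given by a short exact sequence `S`. -/
def projectiveResolutionOfShortExact (hS : S.ShortExact) [Projective S.X₁] [Projective S.X₂] :
    ProjectiveResolution S.X₃ where
  complex := twoTermChain S.f
  projective
    | 0 => Projective.of_iso (twoTermChainXZeroIso S.f).symm inferInstance
    | 1 => Projective.of_iso (twoTermChainXOneIso S.f).symm inferInstance
    | n + 2 => Projective.of_iso (isZero_twoTermChain_X_add_two S.f n).isoZero.symm inferInstance
  π := twoTermChainπ S
  quasiIso := quasiIso_twoTermChainπ hS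

theorem forall_isZero_leftDerived_iff_mono [HasProjectiveResolutions C] (hS : S.ShortExact)
    [Projective S.X₁] [Projective S.X₂] (F : C ⥤ D) [F.Additive] :
    (∀ i, 0 < i → IsZero ((F.leftDerived i).obj S.X₃)) ↔ Mono (F.map S.f) := by
  have hF (i : ℕ) : IsZero ((F.leftDerived i).obj S.X₃) ↔
      ((F.mapHomologicalComplex _).obj (twoTermChain S.f)).ExactAt i :=
    ((projectiveResolutionOfShortExact hS).isoLeftDerivedObj F i).isZero_iff.trans
      (HomologicalComplex.exactAt_iff_isZero_homology _ _).symm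
  simp only [hF, ← exactAt_one_map_twoTermChain_iff]
  refine ⟨fun H => H 1 one_pos, fun H i hi => ?_⟩
  match i with
  | 1 => exact H
  | n + 2 => exact exactAt_add_two_map_twoTermChain S.f F n

end DerivedFunctors

section TwoTerm

variable {A : Type u} [Ring A]

theorem quasiIso_iff_of_f_eq_zero {S₁ S₂ : ShortComplex (ModuleCat.{u} A)} (φ : S₁ ⟶ S₂)
    (h₁ : S₁.f = 0) (h₂ : S₂.f = 0) :
    ShortComplex.QuasiIso φ ↔
      (∀ x, S₁.g x = 0 → φ.τ₂ x = 0 → x = 0) ∧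
      (∀ y, S₂.g y = 0 → ∃ x, S₁.g x = 0 ∧ φ.τ₂ x = y) := by
  have hg (x : S₁.X₂) : S₂.g (φ.τ₂ x) = φ.τ₃ (S₁.g x) :=
    ConcreteCategory.congr_hom φ.comm₂₃ x
  let k : LinearMap.ker S₁.g.hom →ₗ[A] LinearMap.ker S₂.g.hom :=
    φ.τ₂.hom.restrict fun x (hx : S₁.g x = 0) => (hg x).trans (by rw [hx, map_zero])
  have hk := (ShortComplex.LeftHomologyMapData.ofIsLimitKernelFork φ h₁ _
    (ModuleCat.kernelIsLimit S₁.g) h₂ _ (ModuleCat.kernelIsLimit S₂.g)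
    (ModuleCat.ofHom k) rfl).quasiIso_iff
  rw [hk]
  refine (ConcreteCategory.isIso_iff_bijective (ModuleCat.ofHom k)).trans (and_congr ?_ ?_)
  · refine (injective_iff_map_eq_zero k).trans ⟨fun H x hx hx' => ?_, fun H x hx => ?_⟩
    · exact congrArg Subtype.val (H ⟨x, hx⟩ (Subtype.ext hx'))
    · exact Subtype.ext (H x.1 x.2 (congrArg Subtype.val hx))
  · refine ⟨fun H y hy => ?_, fun H y => ?_⟩
    · obtain ⟨x, hx⟩ := H ⟨y, hy⟩
      exact ⟨x.1, x.2, congrArg Subtype.val hx⟩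
    · obtain ⟨x, hx, hxy⟩ := H y.1 y.2
      exact ⟨⟨x, hx⟩, Subtype.ext hxy⟩

theorem quasiIso_iff_of_g_eq_zero {S₁ S₂ : ShortComplex (ModuleCat.{u} A)} (φ : S₁ ⟶ S₂)
    (h₁ : S₁.g = 0) (h₂ : S₂.g = 0) :
    ShortComplex.QuasiIso φ ↔
      (∀ z y, φ.τ₂ z = S₂.f y → ∃ x, S₁.f x = z) ∧
      (∀ w, ∃ z y, φ.τ₂ z + S₂.f y = w) := by
  have hf (x : S₁.X₁) : S₂.f (φ.τ₁ x) = φ.τ₂ (S₁.f x) :=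
    ConcreteCategory.congr_hom φ.comm₁₂ x
  let k : (S₁.X₂ ⧸ LinearMap.range S₁.f.hom) →ₗ[A] (S₂.X₂ ⧸ LinearMap.range S₂.f.hom) :=
    Submodule.mapQ _ _ φ.τ₂.hom (by
      rintro _ ⟨x, rfl⟩
      exact ⟨_, hf x⟩)
  have hk := (ShortComplex.RightHomologyMapData.ofIsColimitCokernelCofork φ h₁ _
    (ModuleCat.cokernelIsColimit S₁.f) h₂ _ (ModuleCat.cokernelIsColimit S₂.f)
    (ModuleCat.ofHom k) rfl).quasiIso_iff
  rw [hk]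
  refine (ConcreteCategory.isIso_iff_bijective (ModuleCat.ofHom k)).trans (and_congr ?_ ?_)
  · refine (injective_iff_map_eq_zero k).trans ⟨fun H z y hz => ?_, fun H t ht => ?_⟩
    · refine (Submodule.Quotient.mk_eq_zero _).1
        (H (Submodule.Quotient.mk z) ((Submodule.Quotient.mk_eq_zero _).2 ⟨y, hz.symm⟩))
    · obtain ⟨z, rfl⟩ := Submodule.Quotient.mk_surjective _ t
      obtain ⟨y, hy⟩ := (Submodule.Quotient.mk_eq_zero _).1 ht
      exact (Submodule.Quotient.mk_eq_zero _).2 (H z y hy.symm)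
  · refine ⟨fun H w => ?_, fun H t => ?_⟩
    · obtain ⟨t, ht⟩ := H (Submodule.Quotient.mk w)
      obtain ⟨z, rfl⟩ := Submodule.Quotient.mk_surjective _ t
      obtain ⟨y, hy : S₂.f y = φ.τ₂ z - w⟩ := (Submodule.Quotient.eq _).1 ht
      exact ⟨z, -y, by rw [map_neg, hy]; abel⟩
    · obtain ⟨w, rfl⟩ := Submodule.Quotient.mk_surjective _ t
      obtain ⟨z, y, rfl⟩ := H w
      refine ⟨Submodule.Quotient.mk z, (Submodule.Quotient.eq _).2 ⟨-y, ?_⟩⟩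
      rw [map_neg]
      abel

variable {P Q P' Q' : ModuleCat.{u} A} {g' : P' ⟶ Q'} {g : P ⟶ Q}

section
variable {l : P ⟶ P'} {r : Q ⟶ Q'}

theorem shortExact_shortComplex_iff_prod_coprod (sq : CommSq g l r g') :
    sq.shortComplex.ShortExact ↔ Function.Injective (g.hom.prod (-l.hom)) ∧
      Function.Exact (g.hom.prod (-l.hom)) (r.hom.coprod g'.hom) ∧
      Function.Surjective (r.hom.coprod g'.hom) := by
  let e := ModuleCat.biprodIsoProd Q P'
  have hf : biprod.lift g (-l) ≫ e.hom = ModuleCat.ofHom (g.hom.prod (-l.hom)) := by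
    rw [← Iso.eq_comp_inv]
    refine biprod.hom_ext _ _ ?_ ?_
    · rw [biprod.lift_fst, Category.assoc, ModuleCat.biprodIsoProd_inv_comp_fst]
      rfl
    · rw [biprod.lift_snd, Category.assoc, ModuleCat.biprodIsoProd_inv_comp_snd]
      rfl
  have hg : e.hom ≫ ModuleCat.ofHom (r.hom.coprod g'.hom) = biprod.desc r g' := by
    rw [← Iso.eq_inv_comp, biprod.desc_eq, Preadditive.comp_add, ← Category.assoc,
      ← Category.assoc, ModuleCat.biprodIsoProd_inv_comp_fst, ModuleCat.biprodIsoProd_inv_comp_snd]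
    rfl
  have w : (r.hom.coprod g'.hom) ∘ₗ (g.hom.prod (-l.hom)) = 0 := by
    ext x
    simpa [← sub_eq_add_neg, sub_eq_zero] using ConcreteCategory.congr_hom sq.w x
  have i : sq.shortComplex ≅ ShortComplex.moduleCatMk _ _ w :=
    ShortComplex.isoMk (Iso.refl _) e (Iso.refl _)
      ((Category.id_comp _).trans hf.symm) (hg.trans (Category.comp_id _).symm)
  rw [ShortComplex.shortExact_iff_of_iso i]
  exact ⟨fun h => ⟨h.moduleCat_injective_f,
    (ShortComplex.ShortExact.moduleCat_exact_iff_function_exact _).1 h.exact,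
    h.moduleCat_surjective_g⟩, fun h => ModuleCat.shortComplex_shortExact _ h.2.1 h.1 h.2.2⟩

theorem shortExact_shortComplex_iff (sq : CommSq g l r g') :
    sq.shortComplex.ShortExact ↔
      (∀ x, g x = 0 → l x = 0 → x = 0) ∧
      (∀ z y, r z = g' y → ∃ x, g x = z ∧ l x = y) ∧
      (∀ w, ∃ z y, r z + g' y = w) := by
  have hw (x : P) : r (g x) = g' (l x) := ConcreteCategory.congr_hom sq.w x
  rw [shortExact_shortComplex_iff_prod_coprod]
  refine and_congr ?_ (and_congr ⟨fun H z y hzy => ?_, fun H => ?_⟩ ?_)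
  · simp [injective_iff_map_eq_zero]
  · obtain ⟨x, hx⟩ := (H (z, -y)).1 (by simp [hzy])
    exact ⟨x, by simpa using hx⟩
  · refine .of_comp_of_mem_range (funext fun x => by simp [hw]) fun ⟨z, y⟩ hzy => ?_
    obtain ⟨x, hx⟩ := H z (-y) (by simpa [← eq_neg_iff_add_eq_zero] using hzy)
    exact ⟨x, by simp [hx]⟩
  · simp [Function.Surjective]

end

/-- The term `P` of `twoTerm (g : P ⟶ Q)`. -/
def twoTermIsoLeft (g : P ⟶ Q) : (twoTerm g).X (-1) ≅ P :=
  HomologicalComplex.doubleXIso₀ g _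

/-- The term `Q` of `twoTerm (g : P ⟶ Q)`. -/
def twoTermIsoRight (g : P ⟶ Q) : (twoTerm g).X 0 ≅ Q :=
  HomologicalComplex.doubleXIso₁ g _ (by simp)

theorem twoTerm_d (g : P ⟶ Q) :
    (twoTerm g).d (-1) 0 = (twoTermIsoLeft g).hom ≫ g ≫ (twoTermIsoRight g).inv :=
  HomologicalComplex.double_d g _ (by simp)

theorem isZero_twoTerm_X (g : P ⟶ Q) (k : ℤ) (h₀ : k ≠ -1) (h₁ : k ≠ 0) :
    IsZero ((twoTerm g).X k) :=
  HomologicalComplex.isZero_double_X g _ k h₀ h₁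

/-- The component `P ⟶ P'` of a map of two-term complexes. -/
def leftComp (φ : twoTerm g ⟶ twoTerm g') : P ⟶ P' :=
  (twoTermIsoLeft g).inv ≫ φ.f (-1) ≫ (twoTermIsoLeft g').hom

/-- The component `Q ⟶ Q'` of a map of two-term complexes. -/
def rightComp (φ : twoTerm g ⟶ twoTerm g') : Q ⟶ Q' :=
  (twoTermIsoRight g).inv ≫ φ.f 0 ≫ (twoTermIsoRight g').hom

theorem commSq_twoTerm (φ : twoTerm g ⟶ twoTerm g') :
    CommSq g (leftComp φ) (rightComp φ) g' where
  w := by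
    have := φ.comm (-1) 0
    rw [twoTerm_d, twoTerm_d] at this
    simp only [leftComp, rightComp, Category.assoc]
    rw [eq_comm, Iso.inv_comp_eq, ← cancel_mono (twoTermIsoRight g').inv]
    simpa using this

theorem exists_leftComp_eq_rightComp_eq {p : P ⟶ P'} {q : Q ⟶ Q'} (sq : CommSq g p q g') :
    ∃ φ : twoTerm g ⟶ twoTerm g', leftComp φ = p ∧ rightComp φ = q := by
  have h₁ : (p ≫ (twoTermIsoLeft g').inv) ≫ (twoTerm g').d (-1) 0 =
      g ≫ q ≫ (twoTermIsoRight g').inv := by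
    simp [twoTerm_d, reassoc_of% sq.w]
  have h₂ (k : ℤ) (hk : (ComplexShape.up ℤ).Rel 0 k) :
      (q ≫ (twoTermIsoRight g').inv) ≫ (twoTerm g').d 0 k = 0 := by
    obtain rfl : k = 1 := by simpa using hk.symm
    exact (isZero_twoTerm_X g' 1 (by simp) (by simp)).eq_of_tgt _ _
  let φ : twoTerm g ⟶ twoTerm g' := HomologicalComplex.mkHomFromDouble _ (by simp) _ _ h₁ h₂
  have hφ₁ : φ.f (-1) = (twoTermIsoLeft g).hom ≫ p ≫ (twoTermIsoLeft g').inv :=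
    HomologicalComplex.mkHomFromDouble_f₀ ..
  have hφ₀ : φ.f 0 = (twoTermIsoRight g).hom ≫ q ≫ (twoTermIsoRight g').inv :=
    HomologicalComplex.mkHomFromDouble_f₁ ..
  exact ⟨φ, by simp [leftComp, hφ₁], by simp [rightComp, hφ₀]⟩

theorem quasiIsoAt_neg_one_iff (φ : twoTerm g ⟶ twoTerm g') :
    QuasiIsoAt φ (-1) ↔
      (∀ x, g x = 0 → leftComp φ x = 0 → x = 0) ∧
      (∀ y, g' y = 0 → ∃ x, g x = 0 ∧ leftComp φ x = y) := by
  rw [quasiIsoAt_iff' φ (-2) (-1) 0 (by simp) (by simp)]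
  let S {P Q : ModuleCat.{u} A} (g : P ⟶ Q) : ShortComplex (ModuleCat.{u} A) :=
    ShortComplex.mk (0 : (twoTerm g).X (-2) ⟶ P) g zero_comp
  let e {P Q : ModuleCat.{u} A} (g : P ⟶ Q) : (twoTerm g).sc' (-2) (-1) 0 ≅ S g :=
    ShortComplex.isoMk (Iso.refl _) (twoTermIsoLeft g) (twoTermIsoRight g)
      ((isZero_twoTerm_X g (-2) (by simp) (by simp)).eq_of_src _ _)
      (by
        change _ = (twoTerm g).d (-1) 0 ≫ _
        rw [twoTerm_d]
        simp [S]
        rfl)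
  let ψ : S g ⟶ S g' :=
    { τ₁ := φ.f (-2)
      τ₂ := leftComp φ
      τ₃ := rightComp φ
      comm₁₂ := by simp [S]
      comm₂₃ := (commSq_twoTerm φ).w.symm }
  refine (ShortComplex.quasiIso_iff_of_arrow_mk_iso _ ψ (Arrow.isoMk (e g) (e g') (by
    ext1
    · exact (Category.id_comp _).trans (Category.comp_id _).symm
    · exact Iso.hom_inv_id_assoc ..
    · exact Iso.hom_inv_id_assoc ..))).trans ?_
  exact quasiIso_iff_of_f_eq_zero ψ rfl rfl

theorem quasiIsoAt_zero_iff (φ : twoTerm g ⟶ twoTerm g') :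
    QuasiIsoAt φ 0 ↔
      (∀ z y, rightComp φ z = g' y → ∃ x, g x = z) ∧
      (∀ w, ∃ z y, rightComp φ z + g' y = w) := by
  rw [quasiIsoAt_iff' φ (-1) 0 1 (by simp) (by simp)]
  let S {P Q : ModuleCat.{u} A} (g : P ⟶ Q) : ShortComplex (ModuleCat.{u} A) :=
    ShortComplex.mk g (0 : Q ⟶ (twoTerm g).X 1) comp_zero
  let e {P Q : ModuleCat.{u} A} (g : P ⟶ Q) : (twoTerm g).sc' (-1) 0 1 ≅ S g :=
    ShortComplex.isoMk (twoTermIsoLeft g) (twoTermIsoRight g) (Iso.refl _)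
      (by
        change _ = (twoTerm g).d (-1) 0 ≫ _
        rw [twoTerm_d]
        simp [S]
        rfl)
      ((isZero_twoTerm_X g 1 (by simp) (by simp)).eq_of_tgt _ _)
  let ψ : S g ⟶ S g' :=
    { τ₁ := leftComp φ
      τ₂ := rightComp φ
      τ₃ := φ.f 1
      comm₁₂ := (commSq_twoTerm φ).w.symm
      comm₂₃ := by simp [S] }
  refine (ShortComplex.quasiIso_iff_of_arrow_mk_iso _ ψ (Arrow.isoMk (e g) (e g') (by
    ext1
    · exact Iso.hom_inv_id_assoc ..
    · exact Iso.hom_inv_id_assoc ..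
    · exact (Category.id_comp _).trans (Category.comp_id _).symm))).trans ?_
  exact quasiIso_iff_of_g_eq_zero ψ rfl rfl

theorem quasiIso_twoTerm_iff (φ : twoTerm g ⟶ twoTerm g') :
    QuasiIso φ ↔ (commSq_twoTerm φ).shortComplex.ShortExact := by
  have hQ : QuasiIso φ ↔ QuasiIsoAt φ (-1) ∧ QuasiIsoAt φ 0 := by
    refine ⟨fun _ => ⟨inferInstance, inferInstance⟩, fun ⟨h₁, h₀⟩ => ⟨fun k => ?_⟩⟩
    obtain rfl | hk := eq_or_ne k (-1)
    · exact h₁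
    obtain rfl | hk' := eq_or_ne k 0
    · exact h₀
    rw [quasiIsoAt_iff_exactAt']
    · exact ShortComplex.exact_of_isZero_X₂ _ (isZero_twoTerm_X g k hk hk')
    · exact ShortComplex.exact_of_isZero_X₂ _ (isZero_twoTerm_X g' k hk hk')
  rw [hQ, quasiIsoAt_neg_one_iff, quasiIsoAt_zero_iff, shortExact_shortComplex_iff]
  have hw (x : P) : g' (leftComp φ x) = rightComp φ (g x) :=
    (ConcreteCategory.congr_hom (commSq_twoTerm φ).w x).symm
  constructor
  · rintro ⟨⟨hker, hker'⟩, hcoker, hcoker'⟩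
    refine ⟨hker, fun z y hzy => ?_, hcoker'⟩
    obtain ⟨x, rfl⟩ := hcoker z y hzy
    obtain ⟨x', hx', hx'y⟩ := hker' (y - leftComp φ x) (by rw [map_sub, hw, hzy, sub_self])
    exact ⟨x + x', by rw [map_add, hx', add_zero], by rw [map_add, hx'y, add_sub_cancel]⟩
  · rintro ⟨hinj, hexact, hsurj⟩
    refine ⟨⟨hinj, fun y hy => hexact 0 y (by rw [map_zero, hy])⟩, fun z y hzy => ?_, hsurj⟩
    exact (hexact z y hzy).imp fun _ => And.left

end TwoTerm

section Resolution

variable {A : Type u} [Ring A]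

theorem exists_shortExact_shortComplex_of_finitePresentation {X M : ModuleCat.{u} A} (t : X ⟶ M)
    [Module.Finite A X] [Module.Projective A X] [Module.FinitePresentation A M]
    [HasProjectiveDimensionLE M 1] :
    ∃ (P Q : ModuleCat.{u} A) (g : P ⟶ Q) (l : P ⟶ X) (r : Q ⟶ M) (sq : CommSq g l r t),
      IsFGProjMap g ∧ sq.shortComplex.ShortExact := by
  obtain ⟨n, -, ε, -, hε, -⟩ := Module.FinitePresentation.exists_fin' A M
  let q : ((Fin n → A) × X) →ₗ[A] M := ε.coprod (-t.hom)
  have hq : Function.Surjective q := fun m => by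
    obtain ⟨y, rfl⟩ := hε m
    exact ⟨(y, 0), by simp [q]⟩
  have hfg : Module.Finite A (LinearMap.ker q) :=
    Module.Finite.iff_fg.2 (Module.FinitePresentation.fg_ker q hq)
  have hproj : Module.Projective A (LinearMap.ker q) := by
    rw [IsProjective.iff_projective, projective_iff_hasProjectiveDimensionLT_one]
    refine (LinearMap.shortExact_shortComplexKer hq).hasProjectiveDimensionLT_X₁ 1 ?_ ‹_›
    have := (ModuleCat.of A ((Fin n → A) × X)).projective_of_module_projective
    exact inferInstanceAs (HasProjectiveDimensionLT (ModuleCat.of A ((Fin n → A) × X)) 1)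
  have mem_ker (y x) : (y, x) ∈ LinearMap.ker q ↔ ε y = t x := by
    simp [q, ← sub_eq_add_neg, sub_eq_zero]
  let p₁ := LinearMap.fst A (Fin n → A) X ∘ₗ (LinearMap.ker q).subtype
  let p₂ := LinearMap.snd A (Fin n → A) X ∘ₗ (LinearMap.ker q).subtype
  refine ⟨_, _, ModuleCat.ofHom p₁, ModuleCat.ofHom p₂, ModuleCat.ofHom ε,
    ⟨ModuleCat.hom_ext (LinearMap.ext fun z => (mem_ker _ _).1 z.2)⟩,
    ⟨⟨hfg, hproj⟩, inferInstance, inferInstance⟩, ?_⟩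
  refine (shortExact_shortComplex_iff _).2 ⟨fun z h₁ h₂ => Subtype.ext (Prod.ext h₁ h₂),
    fun y x hyx => ⟨⟨(y, x), (mem_ker y x).2 hyx⟩, rfl, rfl⟩, fun w => ?_⟩
  obtain ⟨y, rfl⟩ := hε w
  exact ⟨y, 0, by simp⟩

variable {B : Type u} [Ring B] {f : A →+* B}

theorem resolvesCone_iff {P Q : ModuleCat.{u} A} {g : P ⟶ Q} :
    ResolvesCone f g ↔ IsFGProjMap g ∧
      ∃ (l : P ⟶ ModuleCat.of A A) (r : Q ⟶ leftMod f) (sq : CommSq g l r (asModuleHom f)),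
        sq.shortComplex.ShortExact := by
  refine and_congr_right fun _ => ⟨fun ⟨φ, hφ⟩ => ?_, fun ⟨l, r, sq, hS⟩ => ?_⟩
  · exact ⟨_, _, _, (quasiIso_twoTerm_iff φ).1 hφ⟩
  · obtain ⟨φ, rfl, rfl⟩ := exists_leftComp_eq_rightComp_eq sq
    exact ⟨φ, (quasiIso_twoTerm_iff φ).2 hS⟩

end Resolution

section TorVanishing

variable {A B : Type u} [Ring A] [Ring B] {f : A →+* B}

theorem mono_extendScalars_map_of_forall_exists_extension {P Q : ModuleCat.{u} A} {d : P ⟶ Q}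
    (h : ∀ (N : ModuleCat.{u} B) (α : P ⟶ (ModuleCat.restrictScalars f).obj N), ∃ β, d ≫ β = α) :
    Mono ((extendScalars f).map d) := by
  let adj := extendRestrictScalarsAdj f
  obtain ⟨β, hβ⟩ := h _ (adj.unit.app P)
  have : (extendScalars f).map d ≫ (adj.homEquiv _ _).symm β = 𝟙 _ := by
    rw [← adj.homEquiv_naturality_left_symm, hβ, ← adj.homEquiv_id, Equiv.symm_apply_apply]
  exact (SplitMono.mk _ this).mono

theorem IsRingEpi.projective_extendScalars_leftMod (hf : IsRingEpi f) :
    Projective ((extendScalars f).obj (leftMod f)) := by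
  have := (ModuleCat.of A A).projective_of_module_projective
  have : IsIso ((extendScalars f).map (asModuleHom f)) :=
    (inverts_iff_isIso_extendScalars_map f _).1
      (inverts_iff_forall_isLocalFor.2 hf.isLocalFor_asModuleHom)
  exact .of_iso (asIso ((extendScalars f).map (asModuleHom f))) inferInstance

theorem exists_extension_of_mono_extendScalars_map {S : ShortComplex (ModuleCat.{u} A)}
    (hS : S.ShortExact) [Projective ((extendScalars f).obj S.X₃)]
    [hmono : Mono ((extendScalars f).map S.f)] {N : ModuleCat.{u} B}
    (α : S.X₁ ⟶ (ModuleCat.restrictScalars f).obj N) : ∃ β, S.f ≫ β = α := by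
  let adj := extendRestrictScalarsAdj f
  have := adj.isLeftAdjoint
  have := hS.epi_g
  have hFS : (S.map (extendScalars f)).ShortExact :=
    { exact := hS.exact.map_of_epi_of_preservesCokernel _ ‹_› inferInstance
      mono_f := hmono
      epi_g := inferInstanceAs (Epi ((extendScalars f).map S.g)) }
  have : Projective (S.map (extendScalars f)).X₃ := ‹_›
  obtain ⟨ρ, hρ⟩ : ∃ ρ, (extendScalars f).map S.f ≫ ρ = 𝟙 _ :=
    ⟨hFS.splittingOfProjective.r, hFS.splittingOfProjective.f_r⟩
  refine ⟨adj.homEquiv _ _ (ρ ≫ (adj.homEquiv _ _).symm α), ?_⟩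
  rw [← adj.homEquiv_naturality_left, reassoc_of% hρ, Equiv.apply_symm_apply]

theorem IsRingEpi.forall_isZero_torGroup_iff (hf : IsRingEpi f) {P Q : ModuleCat.{u} A}
    [Projective P] [Projective Q] {d : P ⟶ Q} {ε : Q ⟶ leftMod f} {w : d ≫ ε = 0}
    (hS : (ShortComplex.mk d ε w).ShortExact) :
    (∀ i, 0 < i → IsZero (torGroup i (rightMod f) (leftMod f))) ↔
      ∀ (N : ModuleCat.{u} B) (α : P ⟶ (ModuleCat.restrictScalars f).obj N), ∃ β, d ≫ β = α := by
  refine ((forall_isZero_leftDerived_iff_mono hS (tensorFunctor (rightMod f))).trans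
    (mono_tensorFunctor_map_iff f d)).trans
    ⟨fun _ N α => ?_, mono_extendScalars_map_of_forall_exists_extension⟩
  have := hf.projective_extendScalars_leftMod
  exact exists_extension_of_mono_extendScalars_map hS α

end TorVanishing

section Universal

theorem IsLocalFor.isSplitEpi {C : Type*} [Category* C] {P Q E : C} [Projective P] {σ : P ⟶ Q}
    (hE : IsLocalFor σ E) (hQ : IsLocalFor σ Q) (π : E ⟶ Q) [Epi π] : IsSplitEpi π := by
  obtain ⟨s, hs : σ ≫ s = Projective.factorThru σ π⟩ := hE.2 (Projective.factorThru σ π)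
  exact ⟨⟨s, hQ.1 (by simp [reassoc_of% hs])⟩⟩

variable {A : Type u} [Ring A]

/-- Evaluation at `e` on the endomorphism ring of the abelian group underlying `E`. -/
def evalAddMonoidEnd {E : ModuleCat.{u} A} (e : E) : leftMod (Module.toAddMonoidEnd A E) ⟶ E :=
  ModuleCat.ofHom (X := leftMod (Module.toAddMonoidEnd A E))
    { AddMonoidHom.eval (M := E) (N := E) e with map_smul' _ _ := rfl }

theorem IsLocalFor.addMonoidEnd {P Q E : ModuleCat.{u} A} {σ : P ⟶ Q} (hE : IsLocalFor σ E) :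
    IsLocalFor σ (leftMod (Module.toAddMonoidEnd A E)) := by
  constructor
  · intro β γ (hβγ : σ ≫ β = σ ≫ γ)
    have h (e : E) : β ≫ evalAddMonoidEnd e = γ ≫ evalAddMonoidEnd e :=
      hE.1 (by simp [reassoc_of% hβγ])
    exact ModuleCat.hom_ext (LinearMap.ext fun y => AddMonoidHom.ext fun e => congr($(h e) y))
  · intro α
    choose β hβ using fun e => hE.2 (α ≫ evalAddMonoidEnd e)
    let t (x : P) : AddMonoid.End E := α x
    have hβ (e : E) (x : P) : β e (σ x) = t x e := congr($(hβ e) x)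
    have hadd (e e' : E) : β (e + e') = β e + β e' := hE.1 (by
      ext x
      simp [hβ])
    refine ⟨ModuleCat.ofHom (Y := leftMod (Module.toAddMonoidEnd A E))
      { toFun y := AddMonoidHom.mk' (fun e => β e y) fun e e' => by rw [hadd]; rfl
        map_add' y y' := AddMonoidHom.ext fun e => map_add (β e).hom y y'
        map_smul' a y := AddMonoidHom.ext fun e => map_smul (β e).hom a y }, ?_⟩
    exact ModuleCat.hom_ext (LinearMap.ext fun x => AddMonoidHom.ext fun e => hβ e x)

variable {B : Type u} [Ring B] {f : A →+* B} {S : Set (Arrow (ModuleCat.{u} A))}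

theorem IsUniversalLocalisationAt.isRingEpi (hf : IsUniversalLocalisationAt f S) :
    IsRingEpi f where
  left_cancellation {R} k k' hk := by
    have hinv (σ) (hσ : σ ∈ S) : Inverts (k.hom.comp f) σ.hom :=
      inverts_iff_forall_isLocalFor.2 fun N =>
        inverts_iff_forall_isLocalFor.1 (hf.inverts σ hσ) ((ModuleCat.restrictScalars k.hom).obj N)
    exact RingCat.hom_ext ((hf.existsUnique_lift R (k.hom.comp f) hinv).unique rfl
      congr(($hk).hom).symm)

theorem IsUniversalLocalisationAt.isLocalFor_asModuleHom (hf : IsUniversalLocalisationAt f S)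
    {E : ModuleCat.{u} A} (hE : ∀ σ ∈ S, IsLocalFor σ.hom E) : IsLocalFor (asModuleHom f) E := by
  obtain ⟨k, hk, -⟩ := hf.existsUnique_lift (AddMonoid.End E) (Module.toAddMonoidEnd A E)
    fun σ hσ => IsLocalFor.inverts (hf.fgProj σ hσ) (hE σ hσ).addMonoidEnd
  let _ : Module B E := Module.compHom E k
  let M : ModuleCat.{u} A := (ModuleCat.restrictScalars f).obj (ModuleCat.of B E)
  have hM : IsLocalFor (asModuleHom f) M := hf.isRingEpi.isLocalFor_asModuleHom _
  let e : E ≃ₗ[A] M :=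
    { AddEquiv.refl E with
      map_smul' a x := (congr($hk a x)).symm }
  exact hM.of_retract e.toModuleIso.retract

theorem IsUniversalLocalisationAt.exists_extension (hf : IsUniversalLocalisationAt f S)
    {P Q : ModuleCat.{u} A} {d : P ⟶ Q} {ε : Q ⟶ leftMod f} {w : d ≫ ε = 0}
    (hS : (ShortComplex.mk d ε w).ShortExact) (N : ModuleCat.{u} B)
    (α : P ⟶ (ModuleCat.restrictScalars f).obj N) : ∃ β, d ≫ β = α := by
  obtain ⟨E, i, π, w, j, hE, hj : d ≫ j = α ≫ i⟩ := exists_pushout_shortExact hS α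
  have hlocal (M : ModuleCat.{u} B) (σ) (hσ : σ ∈ S) :
      IsLocalFor σ.hom ((ModuleCat.restrictScalars f).obj M) :=
    inverts_iff_forall_isLocalFor.1 (hf.inverts σ hσ) M
  have hEf : IsLocalFor (asModuleHom f) E := hf.isLocalFor_asModuleHom fun σ hσ => by
    obtain ⟨-, -, _⟩ := hf.fgProj σ hσ
    have := σ.right.projective_of_module_projective
    exact .of_shortExact hE (hlocal N σ hσ) (hlocal _ σ hσ)
  have := (ModuleCat.of A A).projective_of_module_projective
  have : Epi π := hE.epi_g
  have := hEf.isSplitEpi (hf.isRingEpi.isLocalFor_asModuleHom _) π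
  let s := ShortComplex.Splitting.ofExactOfSection _ hE.exact (section_ π) (IsSplitEpi.id π)
    hE.mono_f
  exact ⟨j ≫ s.r, by rw [reassoc_of% hj, s.f_r, Category.comp_id]⟩

theorem IsRingEpi.isUniversalLocalisationAt_singleton (hf : IsRingEpi f) {P Q : ModuleCat.{u} A}
    {g : P ⟶ Q} {l : P ⟶ ModuleCat.of A A} {r : Q ⟶ leftMod f} {sq : CommSq g l r (asModuleHom f)}
    (hg : IsFGProjMap g) (hS : sq.shortComplex.ShortExact)
    (hext : ∀ α : P ⟶ leftMod f, ∃ β, biprod.lift g (-l) ≫ β = α) :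
    IsUniversalLocalisationAt f {Arrow.mk g} where
  fgProj := by rintro _ rfl; exact hg
  inverts := by
    rintro _ rfl
    exact IsLocalFor.inverts hg ((hf.isLocalFor_asModuleHom _).of_isPushout_of_exists_extension
      (isPushout_of_shortExact sq hS) hext)
  existsUnique_lift C _ h hh :=
    existsUnique_comp_eq_of_isLocalFor <| IsLocalFor.of_isPushout
      (inverts_iff_forall_isLocalFor.1 (hh _ rfl) (ModuleCat.of C C))
      (isPushout_of_shortExact sq hS)

end Universal

section Main

variable {A B : Type u} [Ring A] [Ring B] {f : A →+* B}

theorem exists_resolvesCone [Module.FinitePresentation A (leftMod f)]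
    [HasProjectiveDimensionLE (leftMod f) 1] :
    ∃ (P Q : ModuleCat.{u} A) (g : P ⟶ Q), ResolvesCone f g := by
  obtain ⟨P, Q, g, l, r, sq, hg, hS⟩ :=
    exists_shortExact_shortComplex_of_finitePresentation (asModuleHom f)
  exact ⟨P, Q, g, resolvesCone_iff.2 ⟨hg, l, r, sq, hS⟩⟩

theorem IsRingEpi.isHomological_iff_forall_exists_extension (hf : IsRingEpi f)
    {P Q : ModuleCat.{u} A} {g : P ⟶ Q} {l : P ⟶ ModuleCat.of A A} {r : Q ⟶ leftMod f}
    {sq : CommSq g l r (asModuleHom f)} (hg : IsFGProjMap g) (hS : sq.shortComplex.ShortExact) :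
    IsHomological f ↔ ∀ (N : ModuleCat.{u} B) (α : P ⟶ (ModuleCat.restrictScalars f).obj N),
      ∃ β, biprod.lift g (-l) ≫ β = α := by
  obtain ⟨⟨-, _⟩, -, _⟩ := hg
  have := P.projective_of_module_projective
  have := Q.projective_of_module_projective
  have := (ModuleCat.of A A).projective_of_module_projective
  exact Iff.trans ⟨IsHomological.tor_eq_zero, IsHomological.mk hf⟩
    (hf.forall_isZero_torGroup_iff (Q := Q ⊞ ModuleCat.of A A) hS)

theorem IsHomological.isUniversalLocalisationAt_singleton (hf : IsHomological f)
    {P Q : ModuleCat.{u} A} {g : P ⟶ Q} (hg : ResolvesCone f g) :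
    IsUniversalLocalisationAt f {Arrow.mk g} := by
  obtain ⟨hg, l, r, sq, hS⟩ := resolvesCone_iff.1 hg
  exact hf.epi.isUniversalLocalisationAt_singleton hg hS
    ((hf.epi.isHomological_iff_forall_exists_extension hg hS).1 hf _)

theorem IsUniversalLocalisation.isHomological (hf : IsUniversalLocalisation f)
    {P Q : ModuleCat.{u} A} {g : P ⟶ Q} (hg : ResolvesCone f g) : IsHomological f := by
  obtain ⟨S, hf⟩ := hf
  obtain ⟨hg, l, r, sq, hS⟩ := resolvesCone_iff.1 hg
  exact (hf.isRingEpi.isHomological_iff_forall_exists_extension hg hS).2 (hf.exists_extension hS)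

end Main

end

end RingEpi

theorem theorem3p2_general {A B : Type u} [Ring A] [Ring B] (f : A →+* B)
    [Module.FinitePresentation A (RingEpi.leftMod f)]
    [CategoryTheory.HasProjectiveDimensionLE (RingEpi.leftMod f) 1] :
    (RingEpi.IsHomological f ↔ RingEpi.IsUniversalLocalisation f) ∧
    (∃ (P Q : ModuleCat.{u} A) (g : P ⟶ Q), RingEpi.ResolvesCone f g) ∧
    (RingEpi.IsHomological f →
      ∀ (P Q : ModuleCat.{u} A) (g : P ⟶ Q), RingEpi.ResolvesCone f g →
        RingEpi.IsUniversalLocalisationAt f {CategoryTheory.Arrow.mk g}) := by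
  obtain ⟨P, Q, g, hg⟩ := RingEpi.exists_resolvesCone (f := f)
  exact ⟨⟨fun hf => ⟨_, hf.isUniversalLocalisationAt_singleton hg⟩, fun hf => hf.isHomological hg⟩,
    ⟨P, Q, g, hg⟩, fun hf _ _ _ hg => hf.isUniversalLocalisationAt_singleton hg⟩

theorem theorem3p2 {A B : Type u} [Ring A] [Ring B] (f : A →+* B)
    (hf : RingEpi.IsOneFinite f) :
    (RingEpi.IsHomological f ↔ RingEpi.IsUniversalLocalisation f) ∧
    (∃ (P Q : ModuleCat.{u} A) (g : P ⟶ Q), RingEpi.ResolvesCone f g) ∧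
    (RingEpi.IsHomological f →
      ∀ (P Q : ModuleCat.{u} A) (g : P ⟶ Q), RingEpi.ResolvesCone f g →
        RingEpi.IsUniversalLocalisationAt f {CategoryTheory.Arrow.mk g}) :=
  have := hf.finitePresentation
  have := hf.projectiveDimension_le_one
  theorem3p2_general f
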